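/- Let $\Lambda$ be a nontrivial finitely generated torsion-free nilpotent group and let $d\geq 1$ be an integer. Let $\mathbb Z^d\wr\Lambda=\big(\bigoplus_{\Lambda}\mathbb Z^d\big)\rtimes\Lambda$ be the (restricted) wreath product, where $\Lambda$ acts on the group of finitely supported functions $f:\Lambda\to\mathbb Z^d$ by $(\gamma\cdot f)(x)=f(\gamma^{-1}x)$. Then $\mathbb Z^d\wr\Lambda$ is an amenable allosteric group. Here a countable group $\Gamma$ is called allosteric if it admits an action by homeomorphisms on some compact metric space $X$, all of whose orbits are dense, together with an ergodic $\Gamma$-invariant Borel probability measure $\mu$ on $X$, such that the set $\{x\in X:\mathrm{Stab}_\Gamma(x)=\{e\}\}$ of points with trivial stabilizer is comeager in $X$ (the action is topologically free) but does not have full $\mu$-measure (the action is not essentially free). The group $\Gamma$ is amenable if there is a finitely additive left-invariant probability measure defined on all subsets of $\Gamma$. -/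

import Mathlib

open MeasureTheory
open scoped ENNReal Pointwise

/-- The shift action of a group `Λ` on the direct sum `⨁_Λ A`, realised as the group of finitely
supported functions `Λ →₀ A` (written multiplicatively): `(γ · f)(x) = f(γ⁻¹ x)`. -/
noncomputable def wreathShift (A Λ : Type*) [AddCommGroup A] [Group Λ] :
    Λ →* MulAut (Multiplicative (Λ →₀ A)) where
  toFun γ := AddEquiv.toMultiplicative (Finsupp.domCongr (Equiv.mulLeft γ))
  map_one' := by
    ext f x
    change Multiplicative.toAdd f (1⁻¹ * x) = Multiplicative.toAdd f x
    simp
  map_mul' γ δ := by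
    ext f x
    change Multiplicative.toAdd f ((γ * δ)⁻¹ * x) = Multiplicative.toAdd f (δ⁻¹ * (γ⁻¹ * x))
    simp [mul_assoc]

/-- The (restricted) wreath product `A ≀ Λ = (⨁_Λ A) ⋊ Λ` of an abelian group `A` by a
group `Λ`. -/
abbrev WreathProduct (A Λ : Type*) [AddCommGroup A] [Group Λ] : Type _ :=
  Multiplicative (Λ →₀ A) ⋊[wreathShift A Λ] Λ

theorem wreathShift_apply {A Λ : Type*} [AddCommGroup A] [Group Λ] (γ : Λ)
    (f : Multiplicative (Λ →₀ A)) (x : Λ) :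
    Multiplicative.toAdd (wreathShift A Λ γ f) x = Multiplicative.toAdd f (γ⁻¹ * x) := rfl

/-- A (discrete) group is amenable if it carries a left-invariant finitely additive probability
measure defined on all of its subsets. -/
def IsAmenableGroup (Γ : Type*) [Group Γ] : Prop :=
  ∃ m : Set Γ → ℝ≥0∞, m Set.univ = 1 ∧
    (∀ s t : Set Γ, Disjoint s t → m (s ∪ t) = m s + m t) ∧
    ∀ (g : Γ) (s : Set Γ), m (g • s) = m s

/-- A minimal ergodic action `Γ ↷ (X, μ)`: an action by homeomorphisms on a compact metric
space in which every orbit is dense, together with an invariant ergodic Borel probability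
measure `μ`. -/
structure IsMinimalErgodicAction (Γ X : Type*) [Group Γ] [MetricSpace X] [MeasurableSpace X]
    [MulAction Γ X] (μ : Measure X) : Prop where
  compactSpace : CompactSpace X
  borelSpace : BorelSpace X
  continuousConstSMul : ContinuousConstSMul Γ X
  isMinimal : MulAction.IsMinimal Γ X
  isProbabilityMeasure : IsProbabilityMeasure μ
  ergodic : ErgodicSMul Γ X μ

/-- The set of points with trivial stabilizer is comeager. -/
def IsTopologicallyFreeAction (Γ X : Type*) [Group Γ] [TopologicalSpace X] [MulAction Γ X] :
    Prop :=
  {x : X | MulAction.stabilizer Γ x = ⊥} ∈ residual X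

/-- The set of points with trivial stabilizer has full measure. -/
def IsEssentiallyFreeAction (Γ : Type*) {X : Type*} [Group Γ] [MeasurableSpace X] [MulAction Γ X]
    (μ : Measure X) : Prop :=
  ∀ᵐ x ∂μ, MulAction.stabilizer Γ x = ⊥

/-- An allosteric action: a minimal ergodic action that is topologically free but not essentially
free. -/
structure IsAllostericAction (Γ X : Type*) [Group Γ] [MetricSpace X] [MeasurableSpace X]
    [MulAction Γ X] (μ : Measure X) : Prop where
  minimalErgodic : IsMinimalErgodicAction Γ X μ
  topologicallyFree : IsTopologicallyFreeAction Γ X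
  not_essentiallyFree : ¬ IsEssentiallyFreeAction Γ μ

/-- An allosteric group: a countable group that admits an allosteric action. (A compact metric
space has at most continuum many points, so it is no restriction to take `X : Type`.) -/
def IsAllostericGroup (Γ : Type*) [Group Γ] : Prop :=
  Countable Γ ∧
    ∃ (X : Type) (_ : MetricSpace X) (_ : MeasurableSpace X) (_ : MulAction Γ X) (μ : Measure X),
      IsAllostericAction Γ X μ

/-! Amenability: commutative groups carry invariant means (ultrafilter limits of averages), and
means on kernel and quotient compose to a mean on an extension. Hence nilpotent groups, and then `(⨁
ℤᵈ) ⋊ Λ`, are amenable.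

Allostery: `Λ` is infinite, and residually finite because it is finitely generated nilpotent. So it
embeds densely in an infinite metrizable profinite group `Y`, where translation is free, minimal and
ergodic for the atomless Haar measure `μ`. This action is extended by the compact group `K = ∏
(ℤ/pₙ)ᵈ` with distinct primes `pₙ`. On `Y × K` the group `Λ` moves only the base, while a finitely
supported `f` translates the fibre over `y` by `∑ γ, c (γ⁻¹ y) (f γ)`. The `n`-th coordinate of `c
y` is reduction modulo `pₙ` if `y ∈ Uₙ` and zero otherwise.

The clopen sets `Uₙ` have total measure below `1`, yet every nonempty open set contains `Uₙ` for
arbitrarily large `n`. Three things follow. Every `Λ`-orbit meets every `Uₙ`, so by the Chinese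
remainder theorem the translations over each `y` are dense in `K`; this gives minimality and, with
Haar measure on `K`, ergodicity. Off `⋃ Uₙ`, a set of positive measure, a function supported at `1`
fixes the fibre, so the action is not essentially free. But any `f ≠ 0` is detected inside any open
set by a suitable late `Uₙ`, so the action is topologically free. -/

/-! ### Invariant means and amenability of nilpotent-by-abelian extensions -/

open Filter Topology in
/-- The values of a bounded real function converge along every ultrafilter. -/
theorem Ultrafilter.tendsto_limUnder_of_abs_le {ι : Type*} (U : Ultrafilter ι) {u : ι → ℝ} {C : ℝ}
    (hu : ∀ i, |u i| ≤ C) : Tendsto u U (𝓝 (limUnder U u)) := by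
  obtain ⟨x, -, hx⟩ := (isCompact_Icc (a := -C) (b := C)).ultrafilter_le_nhds (U.map u)
    (le_principal_iff.2 <| Filter.eventually_map.2 <|
      Eventually.of_forall fun i => abs_le.1 (hu i))
  exact tendsto_nhds_limUnder ⟨x, hx⟩

/-- A mean on a set `G`: a functional on real functions that is, on bounded functions,
additive, monotone and normalised. -/
structure IsMean {G : Type*} (M : (G → ℝ) → ℝ) : Prop where
  mem_Icc : ∀ (f : G → ℝ) (a b : ℝ), (∀ x, f x ∈ Set.Icc a b) → M f ∈ Set.Icc a b
  add : ∀ (f g : G → ℝ) (C : ℝ), (∀ x, |f x| ≤ C) → (∀ x, |g x| ≤ C) →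
    M (fun x => f x + g x) = M f + M g

namespace IsMean

variable {G : Type*} {M : (G → ℝ) → ℝ}

theorem abs_le (hM : IsMean M) {f : G → ℝ} {C : ℝ} (hf : ∀ x, |f x| ≤ C) : |M f| ≤ C :=
  _root_.abs_le.2 (hM.mem_Icc f (-C) C fun x => _root_.abs_le.1 (hf x))

theorem eval (x : G) : IsMean fun f : G → ℝ => f x :=
  ⟨fun _ _ _ h => h x, fun _ _ _ _ _ => rfl⟩

theorem map {H : Type*} (hM : IsMean M) (φ : G → H) :
    IsMean fun f : H → ℝ => M fun x => f (φ x) :=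
  ⟨fun _ a b h => hM.mem_Icc _ a b fun x => h (φ x),
    fun _ _ C hf hg => hM.add _ _ C (fun x => hf (φ x)) fun x => hg (φ x)⟩

theorem average (n : ℕ) {N : ℕ → (G → ℝ) → ℝ} (hN : ∀ i, IsMean (N i)) :
    IsMean fun f => (∑ i ∈ Finset.range (n + 1), N i f) / (n + 1) := by
  refine ⟨fun f a b h => ?_, fun f g C hf hg => ?_⟩
  · have hpos : (0 : ℝ) < n + 1 := by positivity
    have h1 : ∑ i ∈ Finset.range (n + 1), a ≤ ∑ i ∈ Finset.range (n + 1), N i f :=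
      Finset.sum_le_sum fun i _ => ((hN i).mem_Icc f a b h).1
    have h2 : ∑ i ∈ Finset.range (n + 1), N i f ≤ ∑ i ∈ Finset.range (n + 1), b :=
      Finset.sum_le_sum fun i _ => ((hN i).mem_Icc f a b h).2
    simp only [Finset.sum_const, Finset.card_range, nsmul_eq_mul, Nat.cast_add, Nat.cast_one]
      at h1 h2
    exact ⟨by rw [le_div_iff₀ hpos]; linarith, by rw [div_le_iff₀ hpos]; linarith⟩
  · rw [← add_div, ← Finset.sum_add_distrib]
    congr 1
    exact Finset.sum_congr rfl fun i _ => (hN i).add f g C hf hg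

open Filter Topology in
theorem limUnder {ι : Type*} (U : Ultrafilter ι) {N : ι → (G → ℝ) → ℝ}
    (hN : ∀ i, IsMean (N i)) : IsMean fun f => limUnder (U : Filter ι) fun i => N i f := by
  refine ⟨fun f a b h => ?_, fun f g C hf hg => ?_⟩
  · have hmem : ∀ i, N i f ∈ Set.Icc a b := fun i => (hN i).mem_Icc f a b h
    have hb : ∀ i, |N i f| ≤ max |a| |b| := fun i =>
      abs_le_max_abs_abs (hmem i).1 (hmem i).2
    exact isClosed_Icc.mem_of_tendsto (U.tendsto_limUnder_of_abs_le hb) (Eventually.of_forall hmem)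
  · refine Tendsto.limUnder_eq ?_
    simp_rw [fun i => (hN i).add f g C hf hg]
    exact (U.tendsto_limUnder_of_abs_le fun i => (hN i).abs_le hf).add
      (U.tendsto_limUnder_of_abs_le fun i => (hN i).abs_le hg)

end IsMean

/-- Invariance of a functional on bounded functions under left translation by `g`. -/
def IsTranslationInvariant {G : Type*} [Mul G] (M : (G → ℝ) → ℝ) (g : G) : Prop :=
  ∀ (f : G → ℝ) (C : ℝ), (∀ x, |f x| ≤ C) → M (fun x => f (g * x)) = M f

/-- Existence of a left-invariant mean on bounded functions. -/
def HasInvariantMean (G : Type*) [Mul G] : Prop :=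
  ∃ M : (G → ℝ) → ℝ, IsMean M ∧ ∀ g, IsTranslationInvariant M g

-- To add `a` to `S`, average over the translates by `1, a, …, aⁿ` and take an ultrafilter limit.
-- Translation by `a` telescopes to an error of at most `2C/(n+1)`; commutativity preserves the
-- invariance already obtained.
open Filter Topology in
theorem exists_isMean_of_finset {G : Type*} [Group G] (hG : ∀ a b : G, a * b = b * a)
    (S : Finset G) : ∃ M : (G → ℝ) → ℝ, IsMean M ∧ ∀ g ∈ S, IsTranslationInvariant M g := by
  classical
  induction S using Finset.induction_on with
  | empty => exact ⟨_, IsMean.eval 1, by simp⟩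
  | insert a S _ ih =>
    obtain ⟨M, hM, hS⟩ := ih
    let N : ℕ → (G → ℝ) → ℝ := fun i f => M fun x => f (a ^ i * x)
    have hN : ∀ i, IsMean (N i) := fun i => hM.map (a ^ i * ·)
    let A : ℕ → (G → ℝ) → ℝ := fun n f => (∑ i ∈ Finset.range (n + 1), N i f) / (n + 1)
    have hA : ∀ n, IsMean (A n) := fun n => IsMean.average n hN
    refine ⟨_, IsMean.limUnder (hyperfilter ℕ) hA, fun g hg f C hf => ?_⟩
    rcases Finset.mem_insert.1 hg with rfl | hg
    · have h1 := (hyperfilter ℕ).tendsto_limUnder_of_abs_le fun n =>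
        (hA n).abs_le fun x => hf (g * x)
      have h2 := (hyperfilter ℕ).tendsto_limUnder_of_abs_le fun n => (hA n).abs_le hf
      have h3 : Tendsto (fun n => A n (fun x => f (g * x)) - A n f) (hyperfilter ℕ) (𝓝 0) := by
        refine Tendsto.mono_left ?_ Nat.hyperfilter_le_atTop
        have hlim : Tendsto (fun n : ℕ => 2 * C * (1 / ((n : ℝ) + 1))) atTop (𝓝 0) := by
          simpa using tendsto_one_div_add_atTop_nhds_zero_nat.const_mul (2 * C)
        refine squeeze_zero_norm (fun n => ?_) hlim
        have hshift : ∀ i, N i (fun x => f (g * x)) = N (i + 1) f := fun i => by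
          simp only [N, ← mul_assoc, pow_succ']
        have hsum : A n (fun x => f (g * x)) - A n f = (N (n + 1) f - N 0 f) / (n + 1) := by
          simp only [A, hshift, ← sub_div, ← Finset.sum_sub_distrib]
          rw [Finset.sum_range_sub (fun i => N i f)]
        have hpos : (0 : ℝ) < n + 1 := by positivity
        rw [hsum, Real.norm_eq_abs, abs_div, abs_of_pos hpos, div_eq_mul_one_div]
        gcongr
        have := abs_sub (N (n + 1) f) (N 0 f)
        have := (hN (n + 1)).abs_le hf
        have := (hN 0).abs_le hf
        linarith
      exact sub_eq_zero.1 (tendsto_nhds_unique (h1.sub h2) h3)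
    · congr 1
      funext n
      simp only [A]
      congr 1
      refine Finset.sum_congr rfl fun i _ => ?_
      have := hS g hg (fun x => f (a ^ i * x)) C fun x => hf _
      simpa only [N, ← mul_assoc, hG _ g] using this

open Filter Topology in
/-- Commutative groups are amenable. -/
theorem hasInvariantMean_of_comm {G : Type*} [Group G] (hG : ∀ a b : G, a * b = b * a) :
    HasInvariantMean G := by
  choose M hM hinv using exists_isMean_of_finset hG
  let U : Ultrafilter (Finset G) := Ultrafilter.of atTop
  refine ⟨_, IsMean.limUnder U hM, fun g f C hf => ?_⟩
  refine Tendsto.limUnder_eq ((U.tendsto_limUnder_of_abs_le fun S => (hM S).abs_le hf).congr' ?_)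
  refine (Ultrafilter.of_le atTop : (U : Filter (Finset G)) ≤ atTop) ?_
  filter_upwards [eventually_ge_atTop {g}] with S hS
  exact (hinv S g (hS (Finset.mem_singleton_self g)) f C hf).symm

/-- Amenability passes to group extensions. -/
theorem HasInvariantMean.extension {N G Q : Type*} [Group N] [Group G] [Group Q] (i : N →* G)
    (π : G →* Q) (hπ : Function.Surjective π) (hker : π.ker ≤ i.range)
    (hN : HasInvariantMean N) (hQ : HasInvariantMean Q) : HasInvariantMean G := by
  obtain ⟨M, hM, hMi⟩ := hN
  obtain ⟨P, hP, hPi⟩ := hQ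
  choose s hs using hπ
  have hbd : ∀ (f : G → ℝ) (C : ℝ), (∀ x, |f x| ≤ C) →
      ∀ q, |M fun n => f (s q * i n)| ≤ C := fun f C hf q => hM.abs_le fun n => hf _
  refine ⟨fun f => P fun q => M fun n => f (s q * i n), ⟨fun f a b h => ?_, fun f g C hf hg => ?_⟩,
    fun g f C hf => ?_⟩
  · exact hP.mem_Icc _ a b fun q => hM.mem_Icc _ a b fun n => h _
  · simp_rw [fun q => hM.add (fun n => f (s q * i n)) (fun n => g (s q * i n)) C
      (fun n => hf _) fun n => hg _]
    exact hP.add _ _ C (hbd f C hf) (hbd g C hg)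
  · have key : ∀ q, (M fun n => f (g * (s q * i n))) = M fun n => f (s (π g * q) * i n) := by
      intro q
      -- The section `s` is not a homomorphism, but its defect lies in the kernel and is absorbed by
      -- the invariance of `M`.
      obtain ⟨m, hm⟩ : (s (π g * q))⁻¹ * (g * s q) ∈ i.range := hker (by
        simp [MonoidHom.mem_ker, hs])
      rw [← hMi m (fun n => f (s (π g * q) * i n)) C fun n => hf _]
      congr 1
      funext n
      rw [map_mul, hm]
      group
    simp_rw [key]
    exact hPi (π g) (fun q => M fun n => f (s q * i n)) C (hbd f C hf)

theorem hasInvariantMean_of_isNilpotent (G : Type*) [Group G] [Group.IsNilpotent G] :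
    HasInvariantMean G := by
  refine Group.nilpotent_center_quotient_ind (P := fun G _ _ => HasInvariantMean G) G ?_ ?_
  · intro G _ _
    exact hasInvariantMean_of_comm fun a b => Subsingleton.elim _ _
  · intro G _ _ ih
    refine HasInvariantMean.extension (Subgroup.center G).subtype
      (QuotientGroup.mk' (Subgroup.center G)) (QuotientGroup.mk'_surjective _) (by simp) ?_ ih
    exact hasInvariantMean_of_comm fun a b => Subtype.ext (Subgroup.mem_center_iff.1 b.2 a)

/-- An invariant mean restricts to an invariant finitely additive probability measure. -/
theorem HasInvariantMean.isAmenableGroup {G : Type*} [Group G] (h : HasInvariantMean G) :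
    IsAmenableGroup G := by
  classical
  obtain ⟨M, hM, hMi⟩ := h
  have hind : ∀ (s : Set G) (x : G), s.indicator (1 : G → ℝ) x ∈ Set.Icc (0 : ℝ) 1 := fun s x => by
    by_cases hx : x ∈ s <;> simp [hx]
  have habs : ∀ (s : Set G) (x : G), |s.indicator (1 : G → ℝ) x| ≤ 1 := fun s x => by
    by_cases hx : x ∈ s <;> simp [hx]
  refine ⟨fun s => ENNReal.ofReal (M (s.indicator 1)), ?_, fun s t hst => ?_, fun g s => ?_⟩
  · have := hM.mem_Icc (Set.univ.indicator 1) 1 1 (by simp)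
    dsimp only
    rw [le_antisymm this.2 this.1, ENNReal.ofReal_one]
  · rw [← ENNReal.ofReal_add (hM.mem_Icc _ _ _ (hind s)).1 (hM.mem_Icc _ _ _ (hind t)).1,
      ← hM.add _ _ 1 (habs s) (habs t)]
    exact congrArg (fun f => ENNReal.ofReal (M f)) (Set.indicator_union_of_disjoint hst _)
  · dsimp only
    rw [← hMi g ((g • s).indicator 1) 1 (habs _)]
    congr 2
    funext x
    by_cases hx : x ∈ s
    · rw [Set.indicator_of_mem hx,
        Set.indicator_of_mem (by simpa [← smul_eq_mul] using hx)]
      rfl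
    · rw [Set.indicator_of_notMem hx, Set.indicator_of_notMem (by simpa [← smul_eq_mul] using hx)]

/-- The wreath product of an abelian group by a nilpotent group is amenable. -/
theorem isAmenableGroup_wreathProduct (A Λ : Type*) [AddCommGroup A] [Group Λ]
    [Group.IsNilpotent Λ] : IsAmenableGroup (WreathProduct A Λ) := by
  refine (HasInvariantMean.extension SemidirectProduct.inl SemidirectProduct.rightHom
    SemidirectProduct.rightHom_surjective SemidirectProduct.range_inl_eq_ker_rightHom.ge
    (hasInvariantMean_of_comm mul_comm) (hasInvariantMean_of_isNilpotent Λ)).isAmenableGroup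

/-! ### Finitely generated nilpotent groups: Noetherian and residually finite -/

open scoped commutatorElement

namespace Subgroup

theorem fg_of_fg_map_of_fg_inf_ker {G Q : Type*} [Group G] [Group Q] (f : G →* Q)
    {H : Subgroup G} (h1 : (H.map f).FG) (h2 : (H ⊓ f.ker).FG) : H.FG := by
  classical
  obtain ⟨S, hS⟩ := h1
  obtain ⟨T, hT⟩ := h2
  have hsub : (S : Set Q) ⊆ f '' H := by
    rw [← coe_map, ← hS]; exact subset_closure
  obtain ⟨S', hS'H, hS'⟩ := Finset.subset_set_image_iff.1 hsub
  refine ⟨S' ∪ T, le_antisymm ?_ fun x hx => ?_⟩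
  · rw [closure_le, Finset.coe_union]
    refine Set.union_subset hS'H fun t ht => ?_
    have : t ∈ H ⊓ f.ker := hT ▸ subset_closure ht
    exact this.1
  · have hmap : (closure ((S' ∪ T : Finset G) : Set G)).map f ≥ H.map f := by
      rw [← hS, ← hS', Finset.coe_image, ← MonoidHom.map_closure]
      exact map_mono (closure_mono (by simp))
    obtain ⟨y, hy, hyx⟩ := hmap ⟨x, hx, rfl⟩
    have hyH : y ∈ H := by
      refine (closure_le _).2 ?_ hy
      rw [Finset.coe_union]
      refine Set.union_subset hS'H fun t ht => ?_
      have : t ∈ H ⊓ f.ker := hT ▸ subset_closure ht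
      exact this.1
    have : y⁻¹ * x ∈ closure (T : Set G) := by
      rw [hT]
      exact ⟨H.mul_mem (H.inv_mem hyH) hx, by simp [hyx]⟩
    have := mul_mem hy (closure_mono (by simp) this)
    simpa using this

theorem fg_of_le_center {G : Type*} [Group G] {H K : Subgroup G} (hK : K.FG)
    (hc : K ≤ center G) (hHK : H ≤ K) : H.FG := by
  let _ : CommGroup K :=
    { (inferInstance : Group K) with
      mul_comm := fun a b => Subtype.ext (mem_center_iff.1 (hc b.2) a) }
  have : Group.FG K := (Group.fg_iff_subgroup_fg K).2 hK
  have : Module.Finite ℤ (Additive K) := Module.Finite.iff_addGroup_fg.2 inferInstance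
  have hfg : (H.subgroupOf K).FG := by
    rw [Subgroup.fg_iff_add_fg]
    have := IsNoetherian.noetherian (AddSubgroup.toIntSubmodule (Subgroup.toAddSubgroup
      (H.subgroupOf K)))
    rwa [Submodule.fg_iff_addSubgroup_fg, AddSubgroup.toIntSubmodule_toAddSubgroup] at this
  have := ((Subgroup.fg_iff_submonoid_fg _).1 hfg).map K.subtype
  rwa [← map_toSubmonoid, ← Subgroup.fg_iff_submonoid_fg, subgroupOf_map_subtype,
    inf_eq_left.2 hHK] at this

/-- Since `⁅D, ⊤⁆` is central, `⁅x, g⁆` depends on `x` only modulo `⁅D, ⊤⁆`. The commutators of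
lifts of generators of the image of `D` with generators of `G` therefore suffice. -/
theorem commutator_top_fg {G : Type*} [Group G] [Group.FG G] {D : Subgroup G}
    (hc : ⁅D, (⊤ : Subgroup G)⁆ ≤ center G) [hn : (⁅D, (⊤ : Subgroup G)⁆).Normal]
    (hD : (D.map (QuotientGroup.mk' ⁅D, (⊤ : Subgroup G)⁆)).FG) :
    (⁅D, (⊤ : Subgroup G)⁆).FG := by
  classical
  obtain ⟨S, hS⟩ := Group.fg_def.1 (inferInstance : Group.FG G)
  obtain ⟨T, hT⟩ := hD
  have hsub : (T : Set _) ⊆ QuotientGroup.mk' ⁅D, (⊤ : Subgroup G)⁆ '' D := by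
    rw [← coe_map, ← hT]; exact subset_closure
  obtain ⟨T', hT'D, hT'⟩ := Finset.subset_set_image_iff.1 hsub
  let F : Finset G := (T' ×ˢ S).image fun p => ⁅p.1, p.2⁆
  set E : Subgroup G := closure (F : Set G) with hE
  have hEC : E ≤ ⁅D, (⊤ : Subgroup G)⁆ := by
    rw [hE, closure_le]
    intro x hx
    obtain ⟨⟨t, s⟩, hts, rfl⟩ := Finset.mem_image.1 hx
    exact commutator_mem_commutator (hT'D (Finset.mem_product.1 hts).1) (mem_top s)
  have hEn : E.Normal := ⟨fun x hx g => by
    rwa [mem_center_iff.1 (hc (hEC hx)) g, mul_inv_cancel_right]⟩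
  refine ⟨F, le_antisymm hEC (commutator_le.2 fun x hx g _ => ?_)⟩
  -- The elements that are central modulo `E` form a subgroup, so only the lifts `T'` and the
  -- central subgroup `⁅D, ⊤⁆` need checking.
  suffices hDE : D ≤ upperCentralSeriesStep E from hDE hx g
  have hT'E : closure (T' : Set G) ≤ upperCentralSeriesStep E := by
    rw [closure_le]
    intro t ht
    rw [upperCentralSeriesStep_eq_comap_center, SetLike.mem_coe, mem_comap, mem_center_iff]
    have hall : (⊤ : Subgroup G) ≤
        (centralizer {QuotientGroup.mk' E t}).comap (QuotientGroup.mk' E) := by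
      rw [← hS, closure_le]
      intro s hs
      rw [SetLike.mem_coe, mem_comap, mem_centralizer_singleton_iff]
      have hmem : ⁅t, s⁆ ∈ E := subset_closure
        (Finset.mem_coe.2 (Finset.mem_image.2 ⟨(t, s), Finset.mem_product.2 ⟨ht, hs⟩, rfl⟩))
      have h1 : ⁅QuotientGroup.mk' E t, QuotientGroup.mk' E s⁆ = 1 := by
        rw [← map_commutatorElement]
        exact (QuotientGroup.eq_one_iff _).2 hmem
      exact (commutatorElement_eq_one_iff_mul_comm.1 h1).symm
    intro y
    obtain ⟨y, rfl⟩ := QuotientGroup.mk'_surjective E y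
    exact mem_centralizer_singleton_iff.1 (hall (mem_top y))
  have hCE : ⁅D, (⊤ : Subgroup G)⁆ ≤ upperCentralSeriesStep E := fun c hcD y => by
    rw [commutatorElement_eq_one_iff_mul_comm.2 (mem_center_iff.1 (hc hcD) y).symm]
    exact one_mem E
  intro d hd
  have : QuotientGroup.mk' ⁅D, (⊤ : Subgroup G)⁆ d ∈
      (closure (T' : Set G)).map (QuotientGroup.mk' ⁅D, (⊤ : Subgroup G)⁆) := by
    rw [MonoidHom.map_closure, ← Finset.coe_image, hT', hT]
    exact ⟨d, hd, rfl⟩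
  obtain ⟨t, ht, htd⟩ := this
  have h3 : t⁻¹ * d ∈ ⁅D, (⊤ : Subgroup G)⁆ := QuotientGroup.eq.1 htd
  simpa using mul_mem (hT'E ht) (hCE h3)

end Subgroup

namespace Group.IsNilpotent

open Subgroup

/-- Induction on the class: the last term `C` is central, and `G ⧸ C` is Noetherian by induction.
This makes `C` finitely generated by `commutator_top_fg`, and then `H` is an extension of its image
in `G ⧸ C` by a subgroup of `C`. -/
theorem subgroup_fg_of_lowerCentralSeries_eq_bot (n : ℕ) : ∀ (G : Type*) [Group G] [Group.FG G],
    (⊤ : Subgroup G).lowerCentralSeries n = ⊥ → ∀ H : Subgroup G, H.FG := by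
  induction n with
  | zero =>
    intro G _ _ h H
    have : H = ⊥ := le_bot_iff.1 (h ▸ le_top)
    exact this ▸ ⟨∅, by simp⟩
  | succ n ih =>
    intro G _ _ h H
    set C := (⊤ : Subgroup G).lowerCentralSeries n with hC
    have hcen : C ≤ center G := by
      intro x hx
      rw [mem_center_iff]
      intro g
      have : ⁅x, g⁆ ∈ (⊤ : Subgroup G).lowerCentralSeries (n + 1) :=
        commutator_mem_commutator hx (mem_top g)
      rw [h, mem_bot] at this
      exact (commutatorElement_eq_one_iff_mul_comm.1 this).symm
    have hq : (⊤ : Subgroup (G ⧸ C)).lowerCentralSeries n = ⊥ := by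
      have := map_lowerCentralSeries (⊤ : Subgroup G) (QuotientGroup.mk' C) n
      rw [← hC, map_top_of_surjective _ (QuotientGroup.mk'_surjective C)] at this
      rw [← this, QuotientGroup.map_mk'_self]
    have hsub := ih (G ⧸ C) hq
    have hCfg : C.FG := by
      cases n with
      | zero => exact Group.fg_def.1 inferInstance
      | succ m =>
        exact commutator_top_fg hcen (hsub _)
    refine fg_of_fg_map_of_fg_inf_ker (QuotientGroup.mk' C) (hsub _) ?_
    rw [QuotientGroup.ker_mk']
    exact fg_of_le_center hCfg hcen inf_le_right

/-- Finitely generated nilpotent groups are Noetherian. -/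
theorem subgroup_fg {G : Type*} [Group G] [Group.FG G] [Group.IsNilpotent G] (H : Subgroup G) :
    H.FG := by
  obtain ⟨n, hn⟩ := Subgroup.nilpotent_iff_lowerCentralSeries.1 (inferInstance : Group.IsNilpotent G)
  exact subgroup_fg_of_lowerCentralSeries_eq_bot n G hn H

/-- A finitely generated nilpotent group with finite centre is finite. -/
theorem finite_of_finite_center {G : Type*} [Group G] [Group.FG G] [Group.IsNilpotent G]
    [Finite (center G)] : Finite G := by
  obtain ⟨S, hS⟩ := Group.fg_def.1 (inferInstance : Group.FG G)
  have hfin : ∀ n, (Subgroup.upperCentralSeries G n : Set G).Finite := by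
    intro n
    induction n with
    | zero => simp
    | succ n ih =>
      -- Each fibre of `φ` lies in a coset of the centre, because `S` generates `G`; on the next
      -- term of the upper central series, `φ` takes values in a finite set.
      let φ : G → (S → G) := fun x s => ⁅x, (s : G)⁆
      have hpi : (Set.univ.pi fun _ : S => (Subgroup.upperCentralSeries G n : Set G)).Finite :=
        Set.Finite.pi fun _ => ih
      refine (hpi.preimage' (f := φ) fun b _ => ?_).subset fun x hx s _ => hx s
      rcases (φ ⁻¹' {b}).eq_empty_or_nonempty with he | ⟨x, hx⟩
      · simp [he]
      · refine ((Set.toFinite (center G : Set G)).image (x * ·)).subset fun y hy => ?_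
        refine ⟨x⁻¹ * y, ?_, by simp⟩
        have hxy : ∀ s : S, ⁅x, (s : G)⁆ = ⁅y, (s : G)⁆ := fun s =>
          (congrFun hx s).trans (congrFun hy s).symm
        have : (⊤ : Subgroup G) ≤ centralizer {x⁻¹ * y} := by
          rw [← hS, closure_le]
          intro s hs
          rw [SetLike.mem_coe, mem_centralizer_singleton_iff]
          have h := hxy ⟨s, hs⟩
          simp only [commutatorElement_def, mul_left_inj] at h
          have h' : s = x⁻¹ * (y * s * y⁻¹) * x := by rw [← h]; group
          calc s * (x⁻¹ * y) = x⁻¹ * (y * s * y⁻¹) * x * (x⁻¹ * y) := by rw [← h']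
            _ = x⁻¹ * y * s := by group
        exact mem_center_iff.2 fun g => mem_centralizer_singleton_iff.1 (this (mem_top g))
  obtain ⟨n, hn⟩ := IsNilpotent.nilpotent G
  have := hfin n
  rw [hn, coe_top] at this
  exact Set.finite_univ_iff.1 this

/-- A finitely generated nilpotent group all of whose nontrivial normal subgroups contain
a fixed nontrivial element is finite. -/
theorem finite_of_forall_normal_mem {G : Type*} [Group G] [Group.FG G] [Group.IsNilpotent G]
    {g : G} (hg : g ≠ 1) (h : ∀ N : Subgroup G, N.Normal → N ≠ ⊥ → g ∈ N) : Finite G := by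
  have : Group.FG (center G) := (Group.fg_iff_subgroup_fg _).2 (subgroup_fg _)
  have htor : ∀ z ∈ center G, IsOfFinOrder z := by
    intro z hz
    by_contra hz'
    have hinj := injective_zpow_iff_not_isOfFinOrder.2 hz'
    have hmem : ∀ k : ℤ, k ≠ 0 → g ∈ zpowers (z ^ k) := by
      intro k hk
      refine h _ ⟨fun x hx y => ?_⟩ ?_
      · have hxc : x ∈ center G := by
          have : zpowers (z ^ k) ≤ center G := zpowers_le.2 (zpow_mem hz k)
          exact this hx
        rwa [mem_center_iff.1 hxc y, mul_inv_cancel_right]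
      · rw [Ne, zpowers_eq_bot]
        intro h0
        exact hk (hinj (by simpa using h0))
    obtain ⟨m, hm⟩ := mem_zpowers_iff.1 (hmem 1 one_ne_zero)
    rw [zpow_one] at hm
    have hm0 : m ≠ 0 := by rintro rfl; exact hg (by simpa using hm.symm)
    -- With `g = z ^ m`, membership in the powers of `z ^ (2 * m)` would make `2 * m` divide `m ≠
    -- 0`.
    obtain ⟨j, hj⟩ := mem_zpowers_iff.1 (hmem (2 * m) (by omega))
    rw [← zpow_mul, ← hm] at hj
    have h1 : 2 * m * j = m := hinj hj
    have h2 : m * (2 * j - 1) = 0 := by linear_combination h1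
    rcases mul_eq_zero.1 h2 with h3 | h3
    · exact hm0 h3
    · omega
  let _ : CommGroup (center G) :=
    { (inferInstance : Group (center G)) with
      mul_comm := fun a b => Subtype.ext (mem_center_iff.1 b.2 a) }
  have : Finite (center G) := CommGroup.finite_of_fg_isMulTorsion (center G) fun z =>
    (Submonoid.isOfFinOrder_coe (H := (center G).toSubmonoid)).1 (htor z z.2)
  exact finite_of_finite_center

/-- Finitely generated nilpotent groups are residually finite. -/
instance residuallyFinite {G : Type*} [Group G] [Group.FG G] [Group.IsNilpotent G] :
    Group.ResiduallyFinite G := by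
  rw [Group.residuallyFinite_iff_exists_finiteIndex]
  intro g hg
  -- For a maximal normal `N` avoiding `g`, every nontrivial normal subgroup of `G ⧸ N` contains the
  -- image of `g`, so the quotient is finite.
  obtain ⟨N, -, hN⟩ := zorn_le_nonempty₀ {N : Subgroup G | N.Normal ∧ g ∉ N} (by
    intro c hc hchain N₀ hN₀
    refine ⟨sSup c, ⟨?_, ?_⟩, fun N hN => le_sSup hN⟩
    · refine ⟨fun x hx y => ?_⟩
      rw [mem_sSup_of_directedOn ⟨N₀, hN₀⟩ hchain.directedOn] at hx ⊢
      obtain ⟨N, hN, hxN⟩ := hx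
      exact ⟨N, hN, (hc hN).1.conj_mem x hxN y⟩
    · rw [mem_sSup_of_directedOn ⟨N₀, hN₀⟩ hchain.directedOn]
      rintro ⟨N, hN, hgN⟩
      exact (hc hN).2 hgN) ⊥ ⟨inferInstance, by simpa using hg⟩
  have hNn : N.Normal := hN.prop.1
  refine ⟨N, ?_, hN.prop.2⟩
  have : Finite (G ⧸ N) := by
    refine finite_of_forall_normal_mem (g := (g : G ⧸ N))
      (fun h => hN.prop.2 ((QuotientGroup.eq_one_iff g).1 h)) fun K hK hK0 => ?_
    by_contra hgK
    have hle := hN.le_of_ge (y := K.comap (QuotientGroup.mk' N)) ⟨inferInstance, hgK⟩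
      (QuotientGroup.le_comap_mk' N K)
    refine hK0 ((eq_bot_iff_forall K).2 fun x hx => ?_)
    obtain ⟨x, rfl⟩ := QuotientGroup.mk'_surjective N x
    exact (QuotientGroup.eq_one_iff x).2 (hle hx)
  exact finiteIndex_of_finite_quotient

end Group.IsNilpotent

/-! ### Skew products over an action of `Λ` -/

section SkewProduct

variable {Λ A Y K : Type*} [Group Λ] [AddCommGroup A] [MulAction Λ Y] [AddCommGroup K]

/-- The `K`-valued cocycle over an action `Λ ↷ Y` of the group of finitely supported functions
`Λ →₀ A` which is induced by a map `c : Y → Hom(A, K)`: it sends `f` to `∑ γ, c (γ⁻¹ y) (f γ)`. -/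
noncomputable def skewCocycle (Λ : Type*) [Group Λ] [MulAction Λ Y] (c : Y → A →+ K) (y : Y) :
    (Λ →₀ A) →+ K :=
  Finsupp.liftAddHom fun γ => c (γ⁻¹ • y)

theorem skewCocycle_apply (c : Y → A →+ K) (y : Y) (f : Λ →₀ A) :
    skewCocycle Λ c y f = f.sum fun γ a => c (γ⁻¹ • y) a := rfl

theorem skewCocycle_single (c : Y → A →+ K) (y : Y) (γ : Λ) (a : A) :
    skewCocycle Λ c y (Finsupp.single γ a) = c (γ⁻¹ • y) a := by
  simp [skewCocycle]

/-- A reindexing of the sum; this equivariance makes the fibre translations compatible with the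
semidirect product law. -/
theorem skewCocycle_smul (c : Y → A →+ K) (γ : Λ) (y : Y) (f : Multiplicative (Λ →₀ A)) :
    skewCocycle Λ c (γ • y) (wreathShift A Λ γ f).toAdd = skewCocycle Λ c y f.toAdd := by
  rw [skewCocycle_apply, skewCocycle_apply]
  change (Finsupp.equivMapDomain (Equiv.mulLeft γ) f.toAdd).sum _ = _
  rw [Finsupp.equivMapDomain_eq_mapDomain, Finsupp.sum_mapDomain_index (by simp) (by simp)]
  simp [mul_smul]

/-- The action of the wreath product `A ≀ Λ` on `Y × K` in which `Λ` acts on the base `Y` and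
finitely supported functions translate the fibres by the cocycle of `c : Y → Hom(A, K)`. -/
noncomputable abbrev skewAction (c : Y → A →+ K) : MulAction (WreathProduct A Λ) (Y × K) where
  smul g x := (g.right • x.1, x.2 + skewCocycle Λ c (g.right • x.1) g.left.toAdd)
  one_smul x := by
    change ((1 : Λ) • x.1, x.2 + skewCocycle Λ c ((1 : Λ) • x.1) 0) = x
    simp
  mul_smul g h x := by
    change ((g.right * h.right) • x.1, x.2 + skewCocycle Λ c ((g.right * h.right) • x.1)
        (g.left.toAdd + (wreathShift A Λ g.right h.left).toAdd)) =
      (g.right • h.right • x.1, x.2 + skewCocycle Λ c (h.right • x.1) h.left.toAdd +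
        skewCocycle Λ c (g.right • h.right • x.1) g.left.toAdd)
    rw [map_add, mul_smul, skewCocycle_smul]
    congr 1
    abel

theorem skewAction_stabilizer_eq_bot {c : Y → A →+ K} {x : Y × K}
    (hfree : ∀ γ : Λ, γ • x.1 = x.1 → γ = 1) (hx : ∀ f ≠ 0, skewCocycle Λ c x.1 f ≠ 0) :
    letI := skewAction (Λ := Λ) c
    MulAction.stabilizer (WreathProduct A Λ) x = ⊥ := by
  let _ := skewAction (Λ := Λ) c
  rw [Subgroup.eq_bot_iff_forall]
  intro g hg
  have h : (g.right • x.1, x.2 + skewCocycle Λ c (g.right • x.1) g.left.toAdd) = x := hg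
  have h1 : g.right • x.1 = x.1 := congrArg Prod.fst h
  have h2 : x.2 + skewCocycle Λ c (g.right • x.1) g.left.toAdd = x.2 := congrArg Prod.snd h
  have hr := hfree _ h1
  rw [h1, add_eq_left] at h2
  refine SemidirectProduct.ext ?_ hr
  by_contra hne
  exact hx _ (fun h0 => hne (Multiplicative.toAdd.injective h0)) h2

theorem skewAction_stabilizer_ne_bot {c : Y → A →+ K} {x : Y × K} {f : Λ →₀ A} (hf : f ≠ 0)
    (hx : skewCocycle Λ c x.1 f = 0) :
    letI := skewAction (Λ := Λ) c
    MulAction.stabilizer (WreathProduct A Λ) x ≠ ⊥ := by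
  let _ := skewAction (Λ := Λ) c
  intro h
  have hmem : (SemidirectProduct.inl (Multiplicative.ofAdd f) : WreathProduct A Λ) ∈
      MulAction.stabilizer (WreathProduct A Λ) x := by
    change ((1 : Λ) • x.1, x.2 + skewCocycle Λ c ((1 : Λ) • x.1) f) = x
    simp [hx]
  rw [h, Subgroup.mem_bot] at hmem
  exact hf (congrArg (fun g : WreathProduct A Λ => g.left.toAdd) hmem)

variable [TopologicalSpace Y] [TopologicalSpace K]

theorem continuous_skewCocycle [ContinuousConstSMul Λ Y] [ContinuousAdd K] {c : Y → A →+ K}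
    (hc : ∀ a, Continuous fun y => c y a) (f : Λ →₀ A) :
    Continuous fun y => skewCocycle Λ c y f := by
  simp only [skewCocycle_apply, Finsupp.sum]
  exact continuous_finsetSum _ fun γ _ => (hc (f γ)).comp (continuous_const_smul γ⁻¹)

theorem continuousConstSMul_skewAction [ContinuousConstSMul Λ Y] [ContinuousAdd K]
    {c : Y → A →+ K} (hc : ∀ a, Continuous fun y => c y a) :
    letI := skewAction (Λ := Λ) c
    ContinuousConstSMul (WreathProduct A Λ) (Y × K) := by
  let _ := skewAction (Λ := Λ) c
  refine ⟨fun g => ?_⟩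
  have h1 : Continuous fun x : Y × K => g.right • x.1 := continuous_fst.const_smul _
  exact h1.prodMk (continuous_snd.add ((continuous_skewCocycle hc g.left.toAdd).comp h1))

theorem isMinimal_skewAction [MulAction.IsMinimal Λ Y] [IsTopologicalAddGroup K] {c : Y → A →+ K}
    (hd : ∀ y, DenseRange (skewCocycle Λ c y)) :
    letI := skewAction (Λ := Λ) c
    MulAction.IsMinimal (WreathProduct A Λ) (Y × K) := by
  let _ := skewAction (Λ := Λ) c
  refine ⟨fun x => dense_iff_inter_open.2 fun O hO ⟨z, hz⟩ => ?_⟩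
  obtain ⟨V, W, hV, hW, hzV, hzW, hVW⟩ := isOpen_prod_iff.1 hO z.1 z.2 hz
  obtain ⟨_, hγV, γ, rfl⟩ := (MulAction.dense_orbit Λ x.1).inter_open_nonempty V hV ⟨_, hzV⟩
  obtain ⟨_, hk, f, rfl⟩ := ((hd (γ • x.1))).inter_open_nonempty _
    (hW.preimage (continuous_const_add x.2)) ⟨z.2 - x.2, by simpa using hzW⟩
  exact ⟨(γ • x.1, x.2 + skewCocycle Λ c (γ • x.1) f), hVW ⟨hγV, hk⟩,
    ⟨⟨Multiplicative.ofAdd f, γ⟩, rfl⟩⟩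

variable [MeasurableSpace Y] [BorelSpace Y] [MeasurableSpace K] [BorelSpace K]

-- An invariant set has fibres almost invariant under a dense set of translations, so almost every
-- fibre is null or conull. Ergodicity on the base then decides between the two.
open Filter in
theorem ergodicSMul_skewAction [Countable Λ] [Countable A] [ContinuousConstSMul Λ Y]
    [IsTopologicalAddGroup K] [SecondCountableTopology K] [R1Space K]
    {c : Y → A →+ K} (hc : ∀ a, Continuous fun y => c y a)
    (hd : ∀ y, DenseRange (skewCocycle Λ c y)) (μ : Measure Y) [IsProbabilityMeasure μ]
    [ErgodicSMul Λ Y μ] (ν : Measure K) [IsProbabilityMeasure ν] [ν.InnerRegular]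
    [ν.IsAddLeftInvariant] :
    letI := skewAction (Λ := Λ) c
    ErgodicSMul (WreathProduct A Λ) (Y × K) (μ.prod ν) := by
  let _ := skewAction (Λ := Λ) c
  have hmp : ∀ g : WreathProduct A Λ, MeasurePreserving (g • · : Y × K → Y × K)
      (μ.prod ν) (μ.prod ν) := fun g => by
    refine (measurePreserving_smul g.right μ).skew_product
      (g := fun y k => k + skewCocycle Λ c (g.right • y) g.left.toAdd) ?_ ?_
    · exact measurable_snd.add (((continuous_skewCocycle hc g.left.toAdd).comp
        (continuous_const_smul g.right)).measurable.comp measurable_fst)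
    · exact Eventually.of_forall fun y => by
        simp_rw [add_comm _ (skewCocycle Λ c (g.right • y) g.left.toAdd)]
        exact map_add_left_eq_self ν _
  refine { measure_preimage_smul := fun g s hs => (hmp g).measure_preimage hs.nullMeasurableSet
           aeconst_of_forall_preimage_smul_ae_eq := fun {s} hs hinv => ?_ }
  have hfib : ∀ᵐ y ∂μ, ν (Prod.mk y ⁻¹' s) = 0 ∨ ν (Prod.mk y ⁻¹' s)ᶜ = 0 := by
    have h1 : ∀ᵐ y ∂μ, ∀ f : Λ →₀ A, ∀ᵐ k ∂ν,
        ((y, skewCocycle Λ c y f + k) ∈ s ↔ (y, k) ∈ s) := by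
      refine ae_all_iff.2 fun f => Measure.ae_ae_of_ae_prod (p := fun z =>
        ((z.1, skewCocycle Λ c z.1 f + z.2) ∈ s ↔ z ∈ s)) ?_
      filter_upwards [hinv (SemidirectProduct.inl (Multiplicative.ofAdd f))] with z hz
      have hz' : ((1 : Λ) • z.1, z.2 + skewCocycle Λ c ((1 : Λ) • z.1) f) ∈ s ↔ z ∈ s := iff_of_eq hz
      rwa [one_smul, add_comm] at hz'
    filter_upwards [h1] with y hy
    have hsy : MeasurableSet (Prod.mk y ⁻¹' s) := measurable_prodMk_left hs
    have hconst := aeconst_of_dense_setOfPred_preimage_vadd_ae (M := K) (μ := ν)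
      hsy.nullMeasurableSet ((hd y).mono (by
        rintro _ ⟨f, rfl⟩
        filter_upwards [hy f] with k hk
        exact propext hk))
    rcases eventuallyConst_set.1 hconst with h | h
    · exact Or.inr h
    · exact Or.inl (measure_eq_zero_iff_ae_notMem.2 h)
  have hmeas : Measurable fun y => ν (Prod.mk y ⁻¹' s) := measurable_measure_prodMk_left hs
  let t : Set Y := {y | ν (Prod.mk y ⁻¹' s) = 0}
  have ht : MeasurableSet t := hmeas (measurableSet_singleton 0)
  have htinv : ∀ γ : Λ, (γ • ·) ⁻¹' t =ᵐ[μ] t := by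
    intro γ
    have h2 : ∀ᵐ y ∂μ, ∀ᵐ k ∂ν, ((γ • y, k) ∈ s ↔ (y, k) ∈ s) := by
      refine Measure.ae_ae_of_ae_prod (p := fun z => ((γ • z.1, z.2) ∈ s ↔ z ∈ s)) ?_
      filter_upwards [hinv (SemidirectProduct.inr γ)] with z hz
      have hz' : (γ • z.1, z.2 + skewCocycle Λ c (γ • z.1) 0) ∈ s ↔ z ∈ s := iff_of_eq hz
      rwa [map_zero, add_zero] at hz'
    filter_upwards [h2] with y hy
    have : ν (Prod.mk (γ • y) ⁻¹' s) = ν (Prod.mk y ⁻¹' s) :=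
      measure_congr (by filter_upwards [hy] with k hk using propext hk)
    exact propext (by
      change ν (Prod.mk (γ • y) ⁻¹' s) = 0 ↔ ν (Prod.mk y ⁻¹' s) = 0
      rw [this])
  refine eventuallyConst_set.2 ?_
  rcases eventuallyConst_set.1
    (aeconst_of_forall_preimage_smul_ae_eq Λ ht.nullMeasurableSet htinv) with h | h
  · exact Or.inr (measure_eq_zero_iff_ae_notMem.1 ((Measure.measure_prod_null hs).2 h))
  · refine Or.inl (mem_ae_iff.2 ((Measure.measure_prod_null hs.compl).2 ?_))
    filter_upwards [h, hfib] with y hy hy'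
    exact hy'.resolve_left hy

end SkewProduct

/-! ### Criterion for the skew product to be allosteric -/

section Allosteric

open Filter

/-- Freeness on the base leaves only the countably many `f ≠ 0`, and each of them moves all points
over a dense open subset of `Y`. -/
theorem isTopologicallyFreeAction_skewAction {Λ A Y K : Type*} [Group Λ] [AddCommGroup A]
    [MulAction Λ Y] [AddCommGroup K] [TopologicalSpace Y] [TopologicalSpace K]
    [Countable Λ] [Countable A] [ContinuousConstSMul Λ Y] [ContinuousAdd K] [T1Space K]
    {c : Y → A →+ K} (hc : ∀ a, Continuous fun y => c y a)
    (hfree : ∀ (γ : Λ) (y : Y), γ • y = y → γ = 1)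
    (hdense : ∀ f : Λ →₀ A, f ≠ 0 → Dense {y | skewCocycle Λ c y f ≠ 0}) :
    letI := skewAction (Λ := Λ) c
    IsTopologicallyFreeAction (WreathProduct A Λ) (Y × K) := by
  let _ := skewAction (Λ := Λ) c
  have h : ∀ᶠ x : Y × K in residual (Y × K), ∀ f : Λ →₀ A, f ≠ 0 → skewCocycle Λ c x.1 f ≠ 0 := by
    refine eventually_countable_forall.2 fun f => ?_
    by_cases hf : f = 0
    · simp [hf]
    · have : {x : Y × K | skewCocycle Λ c x.1 f ≠ 0} ∈ residual (Y × K) := by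
        refine residual_of_dense_open ?_ ?_
        · exact isOpen_ne.preimage ((continuous_skewCocycle hc f).comp continuous_fst)
        · exact (hdense f hf).preimage isOpenMap_fst
      filter_upwards [this] with x hx _ using hx
  filter_upwards [h] with x hx
  exact skewAction_stabilizer_eq_bot (fun γ => hfree γ x.1) hx

theorem isAllostericGroup_wreathProduct_of_skewAction {Λ A : Type*} {Y K : Type} [Group Λ]
    [AddCommGroup A] [MulAction Λ Y] [AddCommGroup K] [TopologicalSpace Y] [TopologicalSpace K]
    [Countable Λ] [Countable A] [ContinuousConstSMul Λ Y] [MulAction.IsMinimal Λ Y]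
    [CompactSpace Y] [T2Space Y] [SecondCountableTopology Y] [MeasurableSpace Y] [BorelSpace Y]
    (μ : Measure Y) [IsProbabilityMeasure μ] [ErgodicSMul Λ Y μ]
    [IsTopologicalAddGroup K] [CompactSpace K] [T2Space K] [SecondCountableTopology K]
    {c : Y → A →+ K} (hc : ∀ a, Continuous fun y => c y a)
    (hfree : ∀ (γ : Λ) (y : Y), γ • y = y → γ = 1)
    (hd : ∀ y, DenseRange (skewCocycle Λ c y))
    (hdense : ∀ f : Λ →₀ A, f ≠ 0 → Dense {y | skewCocycle Λ c y f ≠ 0})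
    {f : Λ →₀ A} (hf : f ≠ 0) (hμ : μ {y | skewCocycle Λ c y f = 0} ≠ 0) :
    IsAllostericGroup (WreathProduct A Λ) := by
  borelize K
  let ν : Measure K := Measure.addHaarMeasure ⊤
  have : IsProbabilityMeasure ν := ⟨Measure.addHaarMeasure_self⟩
  let _ : MetricSpace (Y × K) := TopologicalSpace.metrizableSpaceMetric (Y × K)
  let _ : MulAction (WreathProduct A Λ) (Y × K) := skewAction c
  have : Countable (Multiplicative (Λ →₀ A)) := inferInstanceAs (Countable (Λ →₀ A))
  refine ⟨(SemidirectProduct.equivProd (φ := wreathShift A Λ)).injective.countable,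
    Y × K, inferInstance, inferInstance, inferInstance, μ.prod ν, ?_⟩
  refine ⟨⟨inferInstance, inferInstance, continuousConstSMul_skewAction hc,
    isMinimal_skewAction hd, inferInstance, ergodicSMul_skewAction hc hd μ ν⟩,
    isTopologicallyFreeAction_skewAction hc hfree hdense, fun h => hμ ?_⟩
  -- Where the cocycle of `f` vanishes, `f` fixes the whole fibre; one point `k` per fibre gives the
  -- contradiction.
  have h1 : ∀ᵐ y ∂μ, ∀ᵐ k ∂ν, MulAction.stabilizer (WreathProduct A Λ) (y, k) = ⊥ :=
    Measure.ae_ae_of_ae_prod h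
  refine measure_eq_zero_iff_ae_notMem.2 ?_
  filter_upwards [h1] with y hy hy0
  obtain ⟨k, hk⟩ := hy.exists
  exact skewAction_stabilizer_ne_bot hf hy0 hk

end Allosteric

/-! ### Clopen sets that are small in measure but topologically ubiquitous -/

open Filter Topology in
/-- Every nonempty open set contains a nonempty clopen set of small measure which is moved off
itself by given nontrivial elements of a group acting freely. -/
theorem exists_isClopen_subset_measure_lt_disjoint {Λ Y : Type*} [Group Λ] [MulAction Λ Y]
    [TopologicalSpace Y] [ContinuousConstSMul Λ Y] [CompactSpace Y] [T2Space Y]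
    [TotallyDisconnectedSpace Y] [MeasurableSpace Y] (μ : Measure Y) [μ.OuterRegular]
    (hμ : ∀ y, μ {y} = 0) (hfree : ∀ (γ : Λ) (y : Y), γ • y = y → γ = 1)
    {V : Set Y} (hV : IsOpen V) (hVne : V.Nonempty) (F : Finset Λ) {ε : ℝ≥0∞} (hε : 0 < ε) :
    ∃ U : Set Y, IsClopen U ∧ U.Nonempty ∧ U ⊆ V ∧ μ U < ε ∧
      ∀ γ ∈ F, γ ≠ 1 → ∀ u ∈ U, γ • u ∉ U := by
  obtain ⟨v, hv⟩ := hVne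
  have h1 : ∀ᶠ U in (𝓝 v).smallSets, μ U < ε := by
    obtain ⟨O, hO, hOo, hOε⟩ := Set.exists_isOpen_lt_of_lt {v} ε (by rwa [hμ v])
    exact eventually_smallSets.2 ⟨O, hOo.mem_nhds (hO rfl),
      fun t ht => (measure_mono ht).trans_lt hOε⟩
  have h2 : ∀ᶠ U in (𝓝 v).smallSets, ∀ γ ∈ F, γ ≠ 1 → ∀ u ∈ U, γ • u ∉ U := by
    refine (Finset.eventually_all F).2 fun γ _ => ?_
    by_cases hγ : γ = 1
    · simp [hγ]
    · obtain ⟨O, O', hO, hO', hvO, hvO', hdisj⟩ := t2_separation (fun h => hγ (hfree γ v h))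
      refine eventually_smallSets.2 ⟨O' ∩ (γ • ·) ⁻¹' O, Filter.inter_mem (hO'.mem_nhds hvO')
        ((hO.preimage (continuous_const_smul γ)).mem_nhds hvO), fun t ht _ u hu hγu => ?_⟩
      exact Set.disjoint_left.1 hdisj (ht hu).2 (ht hγu).1
  have h3 : ∀ᶠ U in (𝓝 v).smallSets, U ⊆ V := eventually_smallSets_subset.2 (hV.mem_nhds hv)
  obtain ⟨N, hN, hN'⟩ := eventually_smallSets.1 (h1.and (h2.and h3))
  obtain ⟨U, hU, hvU, hUN⟩ :=
    compact_exists_isClopen_in_isOpen isOpen_interior (mem_interior_iff_mem_nhds.2 hN)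
  obtain ⟨hU1, hU2, hU3⟩ := hN' U (hUN.trans interior_subset)
  exact ⟨U, hU, ⟨v, hvU⟩, hU3, hU1, hU2⟩

open TopologicalSpace in
/-- A sequence of clopen sets of small total measure which is cofinal among the nonempty open
sets and is eventually moved off itself by every nontrivial element of a group acting freely. -/
theorem exists_seq_isClopen_measure_iUnion_lt {Λ Y : Type*} [Group Λ] [Countable Λ] [MulAction Λ Y]
    [TopologicalSpace Y] [ContinuousConstSMul Λ Y] [CompactSpace Y] [T2Space Y]
    [SecondCountableTopology Y] [Nonempty Y]
    [TotallyDisconnectedSpace Y] [MeasurableSpace Y] (μ : Measure Y) [μ.OuterRegular]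
    (hμ : ∀ y, μ {y} = 0) (hfree : ∀ (γ : Λ) (y : Y), γ • y = y → γ = 1) :
    ∃ U : ℕ → Set Y, (∀ n, IsClopen (U n)) ∧ (∀ n, (U n).Nonempty) ∧ μ (⋃ n, U n) < 1 ∧
      ∀ (S : Finset Λ) (V : Set Y), IsOpen V → V.Nonempty → ∀ N, ∃ n ≥ N, U n ⊆ V ∧
        ∀ γ ∈ S, γ ≠ 1 → ∀ u ∈ U n, γ • u ∉ U n := by
  classical
  obtain ⟨b, hbc, hb0, hb⟩ := exists_countable_basis Y
  have hbne : b.Nonempty := by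
    obtain ⟨V, hV, -⟩ := hb.exists_subset_of_mem_open (Set.mem_univ (Classical.arbitrary Y))
      isOpen_univ
    exact ⟨V, hV⟩
  obtain ⟨B, rfl⟩ := hbc.exists_eq_range hbne
  obtain ⟨e, he⟩ := exists_surjective_nat Λ
  obtain ⟨ε, hε, hεsum⟩ := ENNReal.exists_pos_sum_of_countable' (one_ne_zero (α := ℝ≥0∞)) ℕ
  have hBne : ∀ n, (B n).Nonempty := fun n =>
    Set.nonempty_iff_ne_empty.2 fun h => hb0 ⟨n, h⟩
  choose U hU hUne hUB hUμ hUF using fun n : ℕ =>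
    exists_isClopen_subset_measure_lt_disjoint μ hμ hfree (hb.isOpen ⟨n.unpair.1, rfl⟩)
      (hBne n.unpair.1) ((Finset.range n).image e) (hε n)
  refine ⟨U, hU, hUne, ?_, fun S V hV hVne N => ?_⟩
  · exact ((measure_iUnion_le U).trans (ENNReal.tsum_le_tsum fun n => (hUμ n).le)).trans_lt hεsum
  · obtain ⟨v, hv⟩ := hVne
    obtain ⟨_, ⟨j, rfl⟩, -, hjV⟩ := hb.exists_subset_of_mem_open hv hV
    choose i hi using he
    -- The first component selects the basic set `B j`; the second forces `n ≥ N` and puts `S` among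
    -- the first `n` enumerated elements.
    let n := Nat.pair j (N + ∑ γ ∈ S, (i γ + 1))
    have hn : N + ∑ γ ∈ S, (i γ + 1) ≤ n := Nat.right_le_pair _ _
    refine ⟨n, by omega, ?_, fun γ hγ => hUF n γ ?_⟩
    · refine (hUB n).trans ?_
      simpa [n] using hjV
    · refine Finset.mem_image.2 ⟨i γ, Finset.mem_range.2 ?_, hi γ⟩
      have := Finset.single_le_sum (f := fun γ => i γ + 1) (fun _ _ => Nat.zero_le _) hγ
      omega

/-! ### The cocycle of reductions modulo primes -/

/-- The homomorphism `ℤᵈ → ∏ (ℤ/pₙ)ᵈ` which reduces modulo `pₙ` for those `n` with `y ∈ Uₙ`,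
and is zero in the other factors. -/
noncomputable def indicatorReduction {Y : Type*} (d : ℕ) (p : ℕ → ℕ) (U : ℕ → Set Y) (y : Y) :
    (Fin d → ℤ) →+ (∀ n, Fin d → ZMod (p n)) := by
  classical
  exact AddMonoidHom.mk' (fun a n => if y ∈ U n then fun i => (a i : ZMod (p n)) else 0) (by
    intro a b
    funext n i
    by_cases h : y ∈ U n <;> simp [h])

section IndicatorReduction

variable {Y : Type*} {d : ℕ} {p : ℕ → ℕ} {U : ℕ → Set Y}

theorem indicatorReduction_of_mem {y : Y} {n : ℕ} (h : y ∈ U n) (a : Fin d → ℤ) (i : Fin d) :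
    indicatorReduction d p U y a n i = (a i : ZMod (p n)) := by
  simp [indicatorReduction, h]

theorem indicatorReduction_of_notMem {y : Y} {n : ℕ} (h : y ∉ U n) (a : Fin d → ℤ) :
    indicatorReduction d p U y a n = 0 := by
  simp [indicatorReduction, h]

theorem continuous_indicatorReduction [TopologicalSpace Y] (hU : ∀ n, IsClopen (U n))
    (a : Fin d → ℤ) : Continuous fun y => indicatorReduction d p U y a := by
  classical
  refine continuous_pi fun n => ?_
  have : (fun y => indicatorReduction d p U y a n) =
      fun y => if y ∈ U n then fun i => (a i : ZMod (p n)) else 0 := by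
    funext y
    simp [indicatorReduction]
  rw [this]
  refine continuous_if (fun y hy => ?_) continuousOn_const continuousOn_const
  have : y ∈ frontier (U n) := hy
  simp [(hU n).frontier_eq] at this

theorem exists_intCast_eq_and_forall_intCast_eq_zero (hp : ∀ n, (p n).Prime)
    (hinj : Function.Injective p) (N m : ℕ) (x : ZMod (p m)) :
    ∃ q : ℤ, (q : ZMod (p m)) = x ∧ ∀ n < N, n ≠ m → (q : ZMod (p n)) = 0 := by
  have := Fact.mk (hp m)
  let P : ℕ := ∏ n ∈ (Finset.range N).erase m, p n
  have hP : (P : ZMod (p m)) ≠ 0 := by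
    rw [Ne, ZMod.natCast_eq_zero_iff]
    intro h
    obtain ⟨n, hn, hdvd⟩ := (hp m).prime.exists_mem_finset_dvd h
    exact (Finset.mem_erase.1 hn).1 (hinj ((Nat.prime_dvd_prime_iff_eq (hp m) (hp n)).1 hdvd)).symm
  refine ⟨P * (x * (P : ZMod (p m))⁻¹).val, ?_, fun n hn hnm => ?_⟩
  · push_cast
    rw [ZMod.natCast_zmod_val]
    field_simp
  · have : p n ∣ P := Finset.dvd_prod_of_mem p (by simp [hn, hnm])
    push_cast
    rw [(ZMod.natCast_eq_zero_iff P (p n)).2 this, zero_mul]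

variable {Λ : Type*} [Group Λ] [MulAction Λ Y]

/-- Only coordinates below some `N` matter. For each `m < N`, an integer vector placed at `(γ m)⁻¹`,
congruent to `k m` modulo `p m` and to `0` modulo the other primes, corrects coordinate `m` alone,
whichever other `U n` contain `γ m • y`. -/
theorem denseRange_skewCocycle_indicatorReduction (hp : ∀ n, (p n).Prime)
    (hinj : Function.Injective p) {y : Y} (hy : ∀ n, ∃ γ : Λ, γ • y ∈ U n) :
    DenseRange (skewCocycle Λ (indicatorReduction d p U) y) := by
  intro k
  refine mem_closure_iff.2 fun O hO hk => ?_
  obtain ⟨I, u, hu, hsubset⟩ := isOpen_pi_iff.1 hO k hk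
  obtain ⟨N, hN⟩ := I.exists_nat_subset_range
  choose γ hγ using hy
  choose q hq hq0 using exists_intCast_eq_and_forall_intCast_eq_zero hp hinj N
  let f : Λ →₀ (Fin d → ℤ) :=
    ∑ m ∈ Finset.range N, Finsupp.single (γ m)⁻¹ fun i => q m (k m i)
  refine ⟨skewCocycle Λ (indicatorReduction d p U) y f, hsubset fun n hn => ?_, ⟨f, rfl⟩⟩
  have hnN := Finset.mem_range.1 (hN hn)
  have : skewCocycle Λ (indicatorReduction d p U) y f n = k n := by
    funext i
    simp only [f, map_sum, skewCocycle_single, inv_inv, Finset.sum_apply]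
    rw [Finset.sum_eq_single n]
    · rw [indicatorReduction_of_mem (hγ n), hq]
    · intro m _ hmn
      by_cases hmem : γ m • y ∈ U n
      · rw [indicatorReduction_of_mem hmem, hq0 m _ n hnN hmn.symm]
      · rw [indicatorReduction_of_notMem hmem, Pi.zero_apply]
    · exact fun h => absurd (hN hn) h
  rw [this]
  exact (hu n hn).2

theorem dense_setOf_skewCocycle_indicatorReduction_ne_zero [TopologicalSpace Y]
    [ContinuousConstSMul Λ Y] (hp : ∀ n, n < p n)
    (hU : ∀ n, (U n).Nonempty) (hUV : ∀ (S : Finset Λ) (V : Set Y), IsOpen V → V.Nonempty →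
      ∀ N, ∃ n ≥ N, U n ⊆ V ∧ ∀ γ ∈ S, γ ≠ 1 → ∀ u ∈ U n, γ • u ∉ U n)
    {f : Λ →₀ (Fin d → ℤ)} (hf : f ≠ 0) :
    Dense {y | skewCocycle Λ (indicatorReduction d p U) y f ≠ 0} := by
  classical
  obtain ⟨γ₀, hγ₀⟩ := Finsupp.ne_iff.1 hf
  obtain ⟨i, hi⟩ := Function.ne_iff.1 hγ₀
  refine dense_iff_inter_open.2 fun V hV hVne => ?_
  -- At `γ₀ • u` with `u ∈ U n`, disjointness kills every term of the cocycle except the one at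
  -- `γ₀`; it survives modulo `p n` because `p n > n ≥ |f γ₀ i|`.
  obtain ⟨n, hn, hnV, hdisj⟩ := hUV (f.support.image fun γ => γ⁻¹ * γ₀) (γ₀⁻¹ • V) (hV.smul _)
    (hVne.smul_set) (f γ₀ i).natAbs
  obtain ⟨u, hu⟩ := hU n
  refine ⟨γ₀ • u, Set.mem_inv_smul_set_iff.1 (hnV hu), fun h0 => ?_⟩
  have h1 : skewCocycle Λ (indicatorReduction d p U) (γ₀ • u) f n i = (f γ₀ i : ZMod (p n)) := by
    rw [skewCocycle_apply, Finsupp.sum, Finset.sum_apply, Finset.sum_apply,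
      Finset.sum_eq_single γ₀]
    · rw [inv_smul_smul, indicatorReduction_of_mem hu]
    · intro γ hγ hne
      rw [smul_smul, indicatorReduction_of_notMem (hdisj _ (Finset.mem_image_of_mem _ hγ)
        (fun h => hne (inv_mul_eq_one.1 h)) u hu), Pi.zero_apply]
    · intro h
      exact absurd (Finsupp.notMem_support_iff.1 h) hγ₀
  rw [h0, Pi.zero_apply, Pi.zero_apply] at h1
  have h2 := Int.natAbs_dvd_natAbs.2 ((ZMod.intCast_zmod_eq_zero_iff_dvd _ _).1 h1.symm)
  rw [Int.natAbs_natCast] at h2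
  have h3 := Nat.le_of_dvd (Int.natAbs_pos.2 hi) h2
  have h4 := hp n
  omega

end IndicatorReduction

/-! ### From residual finiteness to allosteric wreath products -/

/-- If `Λ` admits a free minimal ergodic action on a totally disconnected compact metrizable space
with a nonatomic measure, then `ℤᵈ ≀ Λ` is allosteric. -/
theorem isAllostericGroup_wreathProduct_of_free {Λ : Type*} {Y : Type} [Group Λ]
    [MulAction Λ Y] [TopologicalSpace Y]
    [Countable Λ] [ContinuousConstSMul Λ Y] [MulAction.IsMinimal Λ Y]
    [CompactSpace Y] [T2Space Y] [SecondCountableTopology Y] [TotallyDisconnectedSpace Y]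
    [MeasurableSpace Y] [BorelSpace Y]
    (μ : Measure Y) [IsProbabilityMeasure μ] [ErgodicSMul Λ Y μ] (hμ : ∀ y, μ {y} = 0)
    (hfree : ∀ (γ : Λ) (y : Y), γ • y = y → γ = 1) {d : ℕ} (hd : 1 ≤ d) :
    IsAllostericGroup (WreathProduct (Fin d → ℤ) Λ) := by
  have : Nonempty Y := μ.nonempty_of_neZero
  obtain ⟨U, hU, hUne, hUμ, hUV⟩ := exists_seq_isClopen_measure_iUnion_lt μ hμ hfree
  let p : ℕ → ℕ := Nat.nth Nat.Prime
  have hp : ∀ n, (p n).Prime := Nat.prime_nth_prime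
  have hpn : ∀ n, n < p n := fun n => by
    have := Nat.add_two_le_nth_prime n
    change n < Nat.nth Nat.Prime n
    omega
  have hinj : Function.Injective p := Nat.nth_injective Nat.infinite_setOfPred_prime
  have : ∀ n, NeZero (p n) := fun n => ⟨(hp n).ne_zero⟩
  have hf : Finsupp.single (1 : Λ) (fun _ : Fin d => (1 : ℤ)) ≠ 0 := by
    rw [Ne, Finsupp.single_eq_zero]
    exact fun h => one_ne_zero (congrFun h ⟨0, hd⟩)
  refine isAllostericGroup_wreathProduct_of_skewAction μ
    (continuous_indicatorReduction (d := d) (p := p) hU) hfree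
    (fun y => denseRange_skewCocycle_indicatorReduction hp hinj fun n => ?_)
    (fun f hf => dense_setOf_skewCocycle_indicatorReduction_ne_zero hpn hUne hUV hf) hf ?_
  · obtain ⟨_, hx, γ, rfl⟩ :=
      (MulAction.dense_orbit Λ y).inter_open_nonempty _ (hU n).isOpen (hUne n)
    exact ⟨γ, hx⟩
  · intro h0
    have hsub : (⋃ n, U n)ᶜ ⊆ {y | skewCocycle Λ (indicatorReduction d p U) y
        (Finsupp.single 1 fun _ => 1) = 0} := by
      intro y hy
      change skewCocycle Λ (indicatorReduction d p U) y (Finsupp.single 1 fun _ => 1) = 0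
      rw [skewCocycle_single, inv_one, one_smul]
      funext n
      exact indicatorReduction_of_notMem (fun h => hy (Set.mem_iUnion.2 ⟨n, h⟩)) _
    have h1 := measure_mono_null hsub h0
    rw [prob_compl_eq_zero_iff (MeasurableSet.iUnion fun n => (hU n).isOpen.measurableSet)] at h1
    exact hUμ.ne h1

open Topology in
/-- If `Λ` is an infinite countable dense subgroup of a metrizable profinite group, then `ℤᵈ ≀ Λ`
is allosteric. -/
theorem isAllostericGroup_wreathProduct_of_denseRange {Λ : Type*} {Y : Type} [Group Λ] [Countable Λ]
    [Infinite Λ] [Group Y] [TopologicalSpace Y] [IsTopologicalGroup Y] [CompactSpace Y] [T2Space Y]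
    [SecondCountableTopology Y] [TotallyDisconnectedSpace Y] (ι : Λ →* Y)
    (hι : Function.Injective ι) (hdense : DenseRange ι) {d : ℕ} (hd : 1 ≤ d) :
    IsAllostericGroup (WreathProduct (Fin d → ℤ) Λ) := by
  borelize Y
  let μ : Measure Y := Measure.haarMeasure ⊤
  have : IsProbabilityMeasure μ := ⟨Measure.haarMeasure_self⟩
  let _ : MulAction Λ Y := MulAction.compHom Y ι
  have hsmul : ∀ (γ : Λ) (y : Y), γ • y = ι γ * y := fun _ _ => rfl
  have : ContinuousConstSMul Λ Y := ⟨fun γ => continuous_const_mul (ι γ)⟩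
  have : IsScalarTower Λ Y Y := ⟨fun γ y z => mul_assoc (ι γ) y z⟩
  have : MulAction.IsMinimal Λ Y := ⟨fun y => by
    have := (Homeomorph.mulRight y).surjective.denseRange.comp hdense
      (Homeomorph.mulRight y).continuous
    exact this⟩
  have : ErgodicSMul Λ Y μ := ErgodicSMul.trans_isMinimal μ Y
  -- An infinite compact group is not discrete; this is what makes Haar measure atomless.
  have : (𝓝[≠] (1 : Y)).NeBot := by
    by_contra h
    have hinf : Infinite Y := Infinite.of_injective ι hι
    have : DiscreteTopology Y := discreteTopology_of_isOpen_singleton_one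
      (isOpen_singleton_iff_nhds_eq_pure 1 |>.2 (by
        have := Filter.not_neBot.1 h
        rw [← nhdsNE_sup_pure, this, bot_sup_eq]))
    exact not_finite_iff_infinite.2 hinf finite_of_compact_of_discrete
  refine isAllostericGroup_wreathProduct_of_free μ (fun y => measure_singleton y)
    (fun γ y h => hι ?_) hd
  rw [hsmul, mul_eq_right] at h
  rw [h, map_one]

/-- If `Λ` is an infinite countable residually finite group, then `ℤᵈ ≀ Λ` is allosteric. -/
theorem isAllostericGroup_wreathProduct_of_residuallyFinite (Λ : Type*) [Group Λ] [Countable Λ]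
    [Infinite Λ] [Group.ResiduallyFinite Λ] {d : ℕ} (hd : 1 ≤ d) :
    IsAllostericGroup (WreathProduct (Fin d → ℤ) Λ) := by
  obtain ⟨e, he⟩ := exists_surjective_nat Λ
  have hfin : ∀ n, ∃ (G : Type) (_ : Group G) (_ : Finite G) (φ : Λ →* G),
      φ (e n) = 1 → e n = 1 := by
    intro n
    by_cases hn : e n = 1
    · exact ⟨Unit, inferInstance, inferInstance, 1, fun _ => hn⟩
    · obtain ⟨H, hH⟩ := Group.exists_finiteIndexNormalSubgroup_notMem (e n) hn
      -- The finite quotient is copied into `Type`, where the space of an allosteric action has to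
      -- live.
      obtain ⟨G, _, _, ⟨ψ⟩⟩ := Finite.exists_type_univ_nonempty_mulEquiv (Λ ⧸ H.toSubgroup)
      refine ⟨G, inferInstance, inferInstance,
        ψ.toMonoidHom.comp (QuotientGroup.mk' H.toSubgroup), fun h => absurd (?_ : e n ∈ H.toSubgroup) hH⟩
      simpa using h
  choose G _ _ φ hφ using hfin
  let _ : ∀ n, TopologicalSpace (G n) := fun n => ⊥
  have : ∀ n, DiscreteTopology (G n) := fun n => ⟨rfl⟩
  let Φ : Λ →* ∀ n, G n := MonoidHom.pi φ
  have hΦ : Function.Injective Φ := by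
    refine (injective_iff_map_eq_one Φ).2 fun g hg => ?_
    obtain ⟨n, rfl⟩ := he g
    exact hφ n (congrFun hg n)
  let Y : Subgroup (∀ n, G n) := Φ.range.topologicalClosure
  have : CompactSpace Y := isCompact_iff_compactSpace.1 (Φ.range.isClosed_topologicalClosure.isCompact)
  have : SecondCountableTopology Y :=
    TopologicalSpace.Subtype.secondCountableTopology (Y : Set (∀ n, G n))
  let ι : Λ →* Y := Φ.codRestrict Y fun g => Φ.range.le_topologicalClosure ⟨g, rfl⟩
  refine isAllostericGroup_wreathProduct_of_denseRange ι (fun a b h => hΦ (congrArg Subtype.val h))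
    ?_ hd
  intro y
  rw [closure_subtype, ← Set.range_comp]
  exact y.2

theorem corollary1p4 (Λ : Type*) [Group Λ] [Nontrivial Λ] [Group.FG Λ] [Group.IsNilpotent Λ]
    (htf : ∀ g : Λ, g ≠ 1 → ¬ IsOfFinOrder g) (d : ℕ) (hd : 1 ≤ d) :
    IsAmenableGroup (WreathProduct (Fin d → ℤ) Λ) ∧
      IsAllostericGroup (WreathProduct (Fin d → ℤ) Λ) := by
  have : Infinite Λ := by
    obtain ⟨g, hg⟩ := exists_ne (1 : Λ)
    by_contra h
    have := not_infinite_iff_finite.1 h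
    exact htf g hg (isOfFinOrder_of_finite g)
  have : Countable Λ := by
    obtain ⟨α, _, φ, hφ⟩ := Group.fg_iff_exists_freeGroup_hom_surjective_finite.1
      (inferInstance : Group.FG Λ)
    have : Countable (FreeGroup α) := inferInstanceAs (Countable (Quot _))
    exact hφ.countable
  exact ⟨isAmenableGroup_wreathProduct _ Λ,
    isAllostericGroup_wreathProduct_of_residuallyFinite Λ hd⟩
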